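/- Let $\mathbb{K}$ be an infinite field and let $G$ be a free abelian group of rank $2$ with basis $e_1,e_2$, written additively. Let $\mathrm{UT}_3^{(-)}(\mathbb{K})$ be the Lie algebra of upper triangular $3\times 3$ matrices over $\mathbb{K}$ with bracket $[A,B]=AB-BA$, endowed with the universal elementary $G$-grading $\Gamma(e_1,e_2)$, in which the matrix units have degrees $\deg e_{ii}=0$ $(i=1,2,3)$, $\deg e_{12}=e_1$, $\deg e_{23}=e_2$ and $\deg e_{13}=e_1+e_2$. Let $\mathcal{L}(X^G)$ be the free $G$-graded Lie algebra over $\mathbb{K}$ on the variables $X^G=\{x_{i,g}\mid i\in\mathbb{N},\,g\in G\}$, where $\deg x_{i,g}=g$. A $T_G$-ideal is an ideal of $\mathcal{L}(X^G)$ that is stable under all graded endomorphisms of $\mathcal{L}(X^G)$; for $S\subseteq\mathcal{L}(X^G)$, $\langle S\rangle^{T_G}$ denotes the smallest $T_G$-ideal containing $S$. Let $\mathrm{Id}_G(\mathrm{UT}_3^{(-)}(\mathbb{K}),\Gamma(e_1,e_2))$ be the ideal of graded identities, that is, the set of $f\in\mathcal{L}(X^G)$ with $\varphi(f)=0$ for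 every graded homomorphism $\varphi:\mathcal{L}(X^G)\to\mathrm{UT}_3^{(-)}(\mathbb{K})$. Theorem. Let $J$ be a $T_G$-ideal with $\mathrm{Id}_G(\mathrm{UT}_3^{(-)}(\mathbb{K}),\Gamma(e_1,e_2))\subseteq J$. Then there exists a finite subset $S\subseteq\mathcal{L}(X^G)$ such that $$J=\langle S\rangle^{T_G}+\mathrm{Id}_G(\mathrm{UT}_3^{(-)}(\mathbb{K}),\Gamma(e_1,e_2)).$$ -/

import Mathlib

-- Every associative ring (in particular a matrix ring) is a Lie ring under `⁅A, B⁆ = AB - BA`.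
attribute [local instance 100] LieRing.ofAssociativeRing

namespace GradedLie

universe u v w

section Graded

variable {K : Type u} [Field K] {G : Type v}
variable {L : Type*} [LieRing L] [LieAlgebra K L] {M : Type*} [LieRing M] [LieAlgebra K M]

/-- A homomorphism of Lie algebras respecting given families of homogeneous components. -/
def IsGradedHom (A : G → Submodule K L) (B : G → Submodule K M) (φ : L →ₗ⁅K⁆ M) : Prop :=
  ∀ g : G, ∀ a ∈ A g, φ a ∈ B g

end Graded

section Free

variable (K : Type u) [Field K] (G : Type v) [AddCommGroup G]

/-- The free `G`-graded Lie algebra `𝓛(X^G)`: the free Lie algebra on the variables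
`x_{i,g}`, `i ∈ ℕ`, `g ∈ G`, the variable `(i, g)` standing for `x_{i,g}`. -/
abbrev FreeGraded : Type (max u v) := FreeLieAlgebra K (ℕ × G)

variable {G}

/-- The variable `x_{i,g}`. -/
noncomputable def gvar (i : ℕ) (g : G) : FreeGraded K G := FreeLieAlgebra.of K (i, g)

/-- `IsMonomial K g m`: `m` is a Lie monomial (an iterated bracket of variables, in any
arrangement of brackets) whose variables have degrees with sum `g`. -/
inductive IsMonomial : G → FreeGraded K G → Prop
  | of (i : ℕ) (g : G) : IsMonomial g (gvar K i g)
  | lie {g h : G} {a b : FreeGraded K G} :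
      IsMonomial g a → IsMonomial h b → IsMonomial (g + h) ⁅a, b⁆

/-- The homogeneous component of degree `g` of the free `G`-graded Lie algebra. -/
noncomputable def freeComponent (g : G) : Submodule K (FreeGraded K G) :=
  Submodule.span K {m | IsMonomial K g m}

variable {K}

/-- `T_G`-ideals: ideals of `𝓛(X^G)` stable under all graded endomorphisms. -/
def IsTIdeal (J : LieIdeal K (FreeGraded K G)) : Prop :=
  ∀ φ : FreeGraded K G →ₗ⁅K⁆ FreeGraded K G,
    IsGradedHom (freeComponent K) (freeComponent K) φ → ∀ f ∈ J, φ f ∈ J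

/-- The `T_G`-ideal `⟨S⟩^{T_G}` generated by `S`: the smallest `T_G`-ideal containing `S`. -/
noncomputable def tSpan (S : Set (FreeGraded K G)) : LieIdeal K (FreeGraded K G) :=
  sInf {J | IsTIdeal J ∧ S ⊆ (J : Set (FreeGraded K G))}

/-- The ideal `Id_G(L)` of graded identities of a Lie algebra `L` with homogeneous
components `B`: the elements that vanish under all graded homomorphisms `𝓛(X^G) → L`. -/
noncomputable def gradedId {L : Type w} [LieRing L] [LieAlgebra K L] (B : G → Submodule K L) :
    LieIdeal K (FreeGraded K G) where
  carrier := {f | ∀ φ : FreeGraded K G →ₗ⁅K⁆ L, IsGradedHom (freeComponent K) B φ → φ f = 0}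
  add_mem' {a b} ha hb φ hφ := by rw [map_add, ha φ hφ, hb φ hφ, add_zero]
  zero_mem' φ _ := map_zero φ
  smul_mem' c a ha φ hφ := by rw [map_smul, ha φ hφ, smul_zero]
  lie_mem {x a} ha φ hφ := by rw [LieHom.map_lie, ha φ hφ, lie_zero]

end Free

section UpperTriangular

variable (K : Type u) [Field K] {G : Type v} [AddCommGroup G]

/-- The Lie algebra `UT_3^{(-)}(K)` of upper triangular `3 × 3` matrices. -/
def UT3 : LieSubalgebra K (Matrix (Fin 3) (Fin 3) K) where
  carrier := {A | ∀ i j, j < i → A i j = 0}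
  add_mem' {A B} hA hB i j h := by rw [Matrix.add_apply, hA i j h, hB i j h, add_zero]
  zero_mem' _ _ _ := rfl
  smul_mem' c A hA i j h := by rw [Matrix.smul_apply, hA i j h, smul_zero]
  lie_mem' {A B} hA hB i j h := by
    have mul : ∀ {A B : Matrix (Fin 3) (Fin 3) K}, (∀ i j, j < i → A i j = 0) →
        (∀ i j, j < i → B i j = 0) → (A * B) i j = 0 := by
      intro A B hA hB
      rw [Matrix.mul_apply]
      refine Finset.sum_eq_zero fun k _ => ?_
      rcases lt_or_ge k i with hk | hk
      · rw [hA i k hk, zero_mul]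
      · rw [hB k j (lt_of_lt_of_le h hk), mul_zero]
    rw [LieRing.of_associative_ring_bracket, Matrix.sub_apply, mul hA hB, mul hB hA, sub_zero]

/-- The degree of the matrix unit `e_{ij}` (`i ≤ j`) in the elementary grading `Γ(g, h)`:
`deg e_{ii} = 0`, `deg e_{12} = g`, `deg e_{23} = h`, `deg e_{13} = g + h`
(indices start from `0` in the code; the values for `i > j` are never used). -/
def unitDegree (g h : G) (i j : Fin 3) : G := ![0, g, g + h] j - ![0, g, g + h] i

/-- The homogeneous component of degree `γ` of `UT_3^{(-)}(K)` in the elementary grading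
`Γ(g, h)`: the span of the matrix units of degree `γ`, i.e. the upper triangular matrices
all of whose nonzero entries sit at positions of degree `γ`. -/
def elementaryComponent (g h γ : G) : Submodule K (UT3 K) where
  carrier := {A | ∀ i j, (A : Matrix (Fin 3) (Fin 3) K) i j ≠ 0 → unitDegree g h i j = γ}
  add_mem' {A B} hA hB i j hij := by
    by_cases h0 : (A : Matrix (Fin 3) (Fin 3) K) i j = 0
    · refine hB i j fun h1 => hij ?_
      change (A : Matrix (Fin 3) (Fin 3) K) i j + (B : Matrix (Fin 3) (Fin 3) K) i j = 0
      rw [h0, h1, add_zero]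
    · exact hA i j h0
  zero_mem' _ _ hij := absurd rfl hij
  smul_mem' c A hA i j hij := by
    refine hA i j fun h0 => hij ?_
    change c * (A : Matrix (Fin 3) (Fin 3) K) i j = 0
    rw [h0, mul_zero]

end UpperTriangular

end GradedLie

/-! Under every evaluation `x_{j,0}` is a diagonal matrix, so bracketing with it multiplies each
matrix entry by a difference of diagonal entries. Hence, modulo graded identities, the free algebra
is a sum of the span of the `x_{j,0}` and of components governed by polynomials in such differences.
Each component is labelled by its variables of nonzero degree: one of degree `e₁`, `e₂` or `e₁ +
e₂`, or one of degree `e₁` together with one of degree `e₂` (`iSup_component`). Elements of a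
component with the same polynomial differ by an identity (`HasPoly.sub_mem`).

Setting variables to zero shows that a T-ideal containing the identities contains the components of
its elements (`component_mem`). Within a component, the substitutions `x ↦ ⁅x_{j,0}, x⁆` make the
polynomials of a T-ideal an ideal (`polyIdeal`), and renaming the `x_{j,0}` makes it stable under
increasing shifts of indices. Such ideals are finitely generated up to shifts
(`exists_finset_of_shiftStable`), by Higman's lemma and Gröbner reduction. Renaming the other
variables leaves only four kinds of component besides the degree-zero span, so finitely many
generators suffice. -/

namespace GradedLie

universe u v w

/-! ### Cohen's theorem: Noetherianity up to increasing shifts -/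

section Noetherian

open MonomialOrder

/-- Index set of the variables `X (j, b)`, ordered so that a larger `j` gives a larger variable in
the lexicographic monomial order. -/
abbrev VarIdx : Type := (ℕ ×ₗ Bool)ᵒᵈ

/-- The index `(j, b)`. -/
def vidx (j : ℕ) (b : Bool) : VarIdx := OrderDual.toDual (toLex (j, b))

/-- The action of a map `ℕ → ℕ` on the first coordinate of the indices. -/
def shiftIdx (π : ℕ → ℕ) (x : VarIdx) : VarIdx :=
  vidx (π (ofLex (OrderDual.ofDual x)).1) (ofLex (OrderDual.ofDual x)).2

@[simp] lemma shiftIdx_vidx (π : ℕ → ℕ) (j : ℕ) (b : Bool) :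
    shiftIdx π (vidx j b) = vidx (π j) b := rfl

lemma forall_vidx {p : VarIdx → Prop} : (∀ x, p x) ↔ ∀ j b, p (vidx j b) :=
  ⟨fun h _ _ => h _, fun h x => h (ofLex (OrderDual.ofDual x)).1 (ofLex (OrderDual.ofDual x)).2⟩

lemma vidx_lt {i j : ℕ} {b c : Bool} : vidx i b < vidx j c ↔ j < i ∨ j = i ∧ c < b :=
  OrderDual.toDual_lt_toDual.trans Prod.Lex.toLex_lt_toLex

lemma strictMono_shiftIdx {π : ℕ → ℕ} (hπ : StrictMono π) : StrictMono (shiftIdx π) := by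
  intro x y
  revert x
  rw [forall_vidx]
  intro i b
  revert y
  rw [forall_vidx]
  intro j c
  simp only [shiftIdx_vidx, vidx_lt, hπ.lt_iff_lt, hπ.injective.eq_iff, imp_self]

lemma toLex_mapDomain_lt {σ : Type*} [LinearOrder σ] {g : σ → σ} (hg : StrictMono g)
    {a b : σ →₀ ℕ} (h : toLex a < toLex b) :
    toLex (a.mapDomain g) < toLex (b.mapDomain g) := by
  obtain ⟨j, hj, hlt⟩ := h
  refine ⟨g j, fun d hd => ?_, ?_⟩
  · by_cases hr : d ∈ Set.range g
    · obtain ⟨d, rfl⟩ := hr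
      have := hj d (hg.lt_iff_lt.1 hd)
      simpa [Finsupp.mapDomain_apply hg.injective] using this
    · simp [Finsupp.mapDomain_of_notMem_range _ _ hr]
  · simpa [Finsupp.mapDomain_apply hg.injective] using hlt

lemma toLex_mapDomain_le {σ : Type*} [LinearOrder σ] {g : σ → σ} (hg : StrictMono g)
    {a b : σ →₀ ℕ} (h : toLex a ≤ toLex b) :
    toLex (a.mapDomain g) ≤ toLex (b.mapDomain g) := by
  rcases h.lt_or_eq with h | h
  · exact (toLex_mapDomain_lt hg h).le
  · rw [toLex.injective h]

/-- A strictly increasing relabelling preserves the lexicographic order of exponents, so the leading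
monomial stays leading. -/
lemma degree_rename {σ R : Type*} [LinearOrder σ] [WellFoundedGT σ] [CommRing R] {g : σ → σ}
    (hg : StrictMono g) (p : MvPolynomial σ R) :
    (lex (σ := σ)).degree (MvPolynomial.rename g p) = ((lex (σ := σ)).degree p).mapDomain g := by
  classical
  by_cases hp : p = 0
  · simp [hp]
  apply (lex (σ := σ)).toSyn.injective
  refine le_antisymm (degree_le_iff.2 fun d hd => ?_) (le_degree ?_)
  · rw [MvPolynomial.support_rename_of_injective hg.injective, Finset.mem_image] at hd
    obtain ⟨c, hc, rfl⟩ := hd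
    exact toLex_mapDomain_le hg (le_degree (m := lex) hc)
  · rw [MvPolynomial.support_rename_of_injective hg.injective]
    exact Finset.mem_image_of_mem _ (degree_mem_support hp)

/-- Divisibility of monomials up to a strictly increasing change of the variables. -/
def ShiftLE (a b : VarIdx →₀ ℕ) : Prop :=
  ∃ π : ℕ → ℕ, StrictMono π ∧ a.mapDomain (shiftIdx π) ≤ b

lemma exists_bound (a : VarIdx →₀ ℕ) : ∃ n, ∀ j b, n ≤ j → a (vidx j b) = 0 := by
  refine ⟨a.support.sup (fun x => (ofLex (OrderDual.ofDual x)).1) + 1, fun j b hj => ?_⟩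
  by_contra h
  have := Finset.le_sup (f := fun x : VarIdx => (ofLex (OrderDual.ofDual x)).1)
    (Finsupp.mem_support_iff.2 h)
  change j ≤ _ at this
  omega

/-- Higman's lemma for words over `ℕ × ℕ`, whose letters are well-quasi-ordered by Dickson's lemma.
-/
lemma wellQuasiOrdered_shiftLE : WellQuasiOrdered ShiftLE := by
  choose n hn using exists_bound
  -- The `j`-th letter records the exponents of the two variables of index `j`; the word stops where
  -- all later exponents vanish.
  let enc : (VarIdx →₀ ℕ) → List (ℕ × ℕ) := fun a =>
    (List.range (n a)).map fun j => (a (vidx j false), a (vidx j true))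
  have hig := Set.PartiallyWellOrderedOn.partiallyWellOrderedOn_sublistForall₂
    (α := ℕ × ℕ) (· ≤ ·) (s := Set.univ)
    (Set.partiallyWellOrderedOn_univ_iff.2 wellQuasiOrdered_le)
  intro f
  obtain ⟨i, j, hij, h⟩ := hig.exists_lt (f := fun i => enc (f i)) (by simp)
  refine ⟨i, j, hij, ?_⟩
  obtain ⟨l, hl, hs⟩ := List.sublistForall₂_iff.1 h
  obtain ⟨π, hπ⟩ := List.sublist_iff_exists_orderEmbedding_getElem?_eq.1 hs
  refine ⟨π, π.strictMono, ?_⟩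
  have key : ∀ k b, f i (vidx k b) ≤ f j (vidx (π k) b) := by
    intro k b
    rcases lt_or_ge k (n (f i)) with hk | hk
    · have hlen := hl.length_eq
      have hk1 : k < (enc (f i)).length := by simpa [enc] using hk
      have h1 := hl.get hk1 (hlen ▸ hk1)
      have h2 := hπ k
      rw [List.getElem?_eq_getElem (hlen ▸ hk1), eq_comm, List.getElem?_eq_some_iff] at h2
      obtain ⟨h3, h4⟩ := h2
      simp only [List.get_eq_getElem] at h1
      rw [← h4] at h1
      simp only [enc, List.getElem_map, List.getElem_range] at h1
      cases b
      · exact h1.1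
      · exact h1.2
    · rw [hn _ _ _ hk]; exact Nat.zero_le _
  have hinj := (strictMono_shiftIdx π.strictMono).injective
  intro x
  by_cases hr : x ∈ Set.range (shiftIdx π)
  · obtain ⟨y, rfl⟩ := hr
    rw [Finsupp.mapDomain_apply hinj]
    exact key _ _
  · rw [Finsupp.mapDomain_of_notMem_range _ _ hr]; exact Nat.zero_le _

/-- Otherwise elements could be chosen greedily, none lying above an earlier one, giving a bad
sequence. -/
lemma exists_finset_basis {α β : Type*} {r : β → β → Prop} (hr : WellQuasiOrdered r) (d : α → β)
    (P : α → Prop) : ∃ s : Finset α, (∀ x ∈ s, P x) ∧ ∀ y, P y → ∃ x ∈ s, r (d x) (d y) := by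
  by_contra! h
  obtain ⟨f, -, hf⟩ := exists_seq_of_forall_finset_exists P (fun x y => ¬ r (d x) (d y)) h
  obtain ⟨i, j, hij, h'⟩ := hr fun n => d (f n)
  exact hf i j hij h'

/-- Stability of a set of polynomials under strictly increasing changes of the variables. -/
def ShiftStable {K : Type u} [Field K] (I : Ideal (MvPolynomial VarIdx K)) : Prop :=
  ∀ π : ℕ → ℕ, StrictMono π → ∀ p ∈ I, MvPolynomial.rename (shiftIdx π) p ∈ I

/-- Cohen's theorem: shift-stable ideals are finitely generated up to shifts. -/
theorem exists_finset_of_shiftStable {K : Type u} [Field K] (I : Ideal (MvPolynomial VarIdx K))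
    (hI : ShiftStable I) : ∃ F : Finset (MvPolynomial VarIdx K), (∀ p ∈ F, p ∈ I) ∧
      ∀ I' : Ideal (MvPolynomial VarIdx K), ShiftStable I' → (∀ p ∈ F, p ∈ I') → I ≤ I' := by
  obtain ⟨F, hF, hb⟩ := exists_finset_basis wellQuasiOrdered_shiftLE
    (lex (σ := VarIdx)).degree (fun p : MvPolynomial VarIdx K => p ∈ I ∧ p ≠ 0)
  refine ⟨F, fun p hp => (hF p hp).1, fun I' hI' hFI' => ?_⟩
  -- Gröbner reduction, by well-founded induction on the leading monomial: a shift of some element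
  -- of `F`, times a monomial, cancels the leading term of `p`.
  suffices ∀ (d : (lex (σ := VarIdx)).syn) (p : MvPolynomial VarIdx K), p ∈ I →
      (lex (σ := VarIdx)).toSyn ((lex (σ := VarIdx)).degree p) = d → p ∈ I' from
    fun p hp => this _ p hp rfl
  intro d
  induction d using WellFoundedLT.induction with
  | ind d ih =>
  intro p hp hd
  by_cases hp0 : p = 0
  · simp [hp0]
  obtain ⟨q, hq, π, hπ, hle⟩ := hb p ⟨hp, hp0⟩
  have hg := strictMono_shiftIdx hπ
  set q' := MvPolynomial.rename (shiftIdx π) q with hq'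
  have hq0' : q' ≠ 0 := by
    rw [hq', Ne, MvPolynomial.rename_eq_zero_iff_of_injective _ hg.injective]
    exact (hF q hq).2
  rw [← degree_rename hg, ← hq'] at hle
  set m : MvPolynomial VarIdx K := MvPolynomial.monomial
    (lex.degree p - lex.degree q') (lex.leadingCoeff p / lex.leadingCoeff q') with hm
  have hlc : (lex (σ := VarIdx)).leadingCoeff q' ≠ 0 := leadingCoeff_ne_zero_iff.2 hq0'
  have hlp : (lex (σ := VarIdx)).leadingCoeff p ≠ 0 := leadingCoeff_ne_zero_iff.2 hp0
  have hm0 : m ≠ 0 := by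
    rw [hm, Ne, MvPolynomial.monomial_eq_zero]
    exact div_ne_zero hlp hlc
  have hdeg : (lex (σ := VarIdx)).degree (m * q') = lex.degree p := by
    classical
    rw [degree_mul hm0 hq0', hm, degree_monomial, if_neg (div_ne_zero hlp hlc),
      tsub_add_cancel_of_le hle]
  have hlead : (lex (σ := VarIdx)).leadingCoeff (m * q') = lex.leadingCoeff p := by
    rw [leadingCoeff_mul, hm, leadingCoeff_monomial, div_mul_cancel₀ _ hlc]
  have hmq : m * q' ∈ I' := I'.mul_mem_left _ (hI' π hπ q (hFI' q hq))
  have hmqI : m * q' ∈ I := I.mul_mem_left _ (hI π hπ q (hF q hq).1)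
  by_cases hz : p - m * q' = 0
  · rw [sub_eq_zero.1 hz]; exact hmq
  have hlt : (lex (σ := VarIdx)).toSyn (lex.degree (p - m * q')) < d := by
    rw [← hd]
    refine lt_of_le_of_ne ?_ fun h => ?_
    · refine (degree_sub_le (m := lex)).trans ?_
      rw [hdeg, max_self]
    · have h1 := (lex (σ := VarIdx)).toSyn.injective h
      have h2 : (lex (σ := VarIdx)).leadingCoeff (p - m * q') = 0 := by
        rw [leadingCoeff, h1, MvPolynomial.coeff_sub]
        have : (m * q').coeff (lex.degree p) = lex.leadingCoeff p := by
          rw [← hlead, leadingCoeff, hdeg]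
        rw [this]; exact sub_self _
      exact hz (leadingCoeff_eq_zero_iff.1 h2)
  have := ih _ hlt (p - m * q') (I.sub_mem hp hmqI) rfl
  simpa using I'.add_mem this hmq

end Noetherian

/-! ### Graded substitutions and T-ideals -/

section Substitutions

variable {K : Type u} [Field K] {G : Type v}

/-- The endomorphism of the free graded Lie algebra with prescribed values on the variables. -/
noncomputable def subst (y : ℕ → G → FreeGraded K G) : FreeGraded K G →ₗ⁅K⁆ FreeGraded K G :=
  FreeLieAlgebra.lift K fun x => y x.1 x.2

@[simp] lemma subst_gvar (y : ℕ → G → FreeGraded K G) (i : ℕ) (g : G) :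
    subst y (gvar K i g) = y i g :=
  FreeLieAlgebra.lift_of_apply _ _

variable [AddCommGroup G]

lemma gvar_mem_freeComponent (i : ℕ) (g : G) : gvar K i g ∈ freeComponent K g :=
  Submodule.subset_span (IsMonomial.of i g)

lemma lie_mem_freeComponent {g h : G} {a b : FreeGraded K G} (ha : a ∈ freeComponent K g)
    (hb : b ∈ freeComponent K h) : ⁅a, b⁆ ∈ freeComponent K (g + h) := by
  induction ha using Submodule.span_induction with
  | mem a ha =>
    induction hb using Submodule.span_induction with
    | mem b hb => exact Submodule.subset_span (IsMonomial.lie ha hb)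
    | zero => rw [lie_zero]; exact Submodule.zero_mem _
    | add x y _ _ hx hy => rw [lie_add]; exact Submodule.add_mem _ hx hy
    | smul c x _ hx => rw [lie_smul]; exact Submodule.smul_mem _ _ hx
  | zero => rw [zero_lie]; exact Submodule.zero_mem _
  | add x y _ _ hx hy => rw [add_lie]; exact Submodule.add_mem _ hx hy
  | smul c x _ hx => rw [smul_lie]; exact Submodule.smul_mem _ _ hx

lemma isGradedHom_subst {y : ℕ → G → FreeGraded K G} (hy : ∀ i g, y i g ∈ freeComponent K g) :
    IsGradedHom (freeComponent K) (freeComponent K) (subst y) := by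
  intro g a ha
  induction ha using Submodule.span_induction with
  | mem a ha =>
    induction ha with
    | of i g => rw [subst_gvar]; exact hy i g
    | lie _ _ h1 h2 => rw [LieHom.map_lie]; exact lie_mem_freeComponent h1 h2
  | zero => rw [map_zero]; exact Submodule.zero_mem _
  | add x y _ _ hx hy => rw [map_add]; exact Submodule.add_mem _ hx hy
  | smul c x _ hx => rw [map_smul]; exact Submodule.smul_mem _ _ hx

lemma IsGradedHom.comp {L : Type w} [LieRing L] [LieAlgebra K L] {B : G → Submodule K L}
    {ψ : FreeGraded K G →ₗ⁅K⁆ L} (hψ : IsGradedHom (freeComponent K) B ψ)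
    {φ : FreeGraded K G →ₗ⁅K⁆ FreeGraded K G}
    (hφ : IsGradedHom (freeComponent K) (freeComponent K) φ) :
    IsGradedHom (freeComponent K) B (ψ.comp φ) :=
  fun g a ha => hψ g _ (hφ g a ha)

/-- Renaming of variables, preserving degrees. -/
noncomputable def renameVar (r : G → ℕ → ℕ) : FreeGraded K G →ₗ⁅K⁆ FreeGraded K G :=
  subst fun i g => gvar K (r g i) g

lemma isGradedHom_renameVar (r : G → ℕ → ℕ) :
    IsGradedHom (freeComponent K) (freeComponent K) (renameVar (K := K) r) :=
  isGradedHom_subst fun _ _ => gvar_mem_freeComponent _ _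

open Classical in
/-- The substitution keeping the variables satisfying `A` and sending the others to zero. -/
noncomputable def keep (A : ℕ → G → Prop) : FreeGraded K G →ₗ⁅K⁆ FreeGraded K G :=
  subst fun i g => if A i g then gvar K i g else 0

lemma isGradedHom_keep (A : ℕ → G → Prop) :
    IsGradedHom (freeComponent K) (freeComponent K) (keep (K := K) A) :=
  isGradedHom_subst fun i g => by
    split_ifs
    exacts [gvar_mem_freeComponent _ _, Submodule.zero_mem _]

open Classical in
/-- The substitution replacing each variable `x` of degree `γ` by `⁅x_{j,0}, x⁆`. -/
noncomputable def adVar (γ : G) (j : ℕ) : FreeGraded K G →ₗ⁅K⁆ FreeGraded K G :=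
  subst fun i g => if g = γ then ⁅gvar K j (0 : G), gvar K i g⁆ else gvar K i g

lemma isGradedHom_adVar (γ : G) (j : ℕ) :
    IsGradedHom (freeComponent K) (freeComponent K) (adVar (K := K) γ j) :=
  isGradedHom_subst fun i g => by
    split_ifs
    · simpa using lie_mem_freeComponent (gvar_mem_freeComponent (K := K) j 0)
        (gvar_mem_freeComponent i g)
    · exact gvar_mem_freeComponent _ _

lemma isTIdeal_gradedId {L : Type w} [LieRing L] [LieAlgebra K L] (B : G → Submodule K L) :
    IsTIdeal (gradedId (K := K) B) :=
  fun φ hφ _ hf ψ hψ => hf (ψ.comp φ) (hψ.comp hφ)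

lemma subset_tSpan (S : Set (FreeGraded K G)) : S ⊆ (tSpan S : Set (FreeGraded K G)) := by
  rw [tSpan, LieSubmodule.coe_sInf]
  exact Set.subset_iInter₂ fun J hJ => hJ.2

lemma tSpan_le {S : Set (FreeGraded K G)} {J : LieIdeal K (FreeGraded K G)} (hJ : IsTIdeal J)
    (hS : S ⊆ J) : tSpan S ≤ J :=
  sInf_le ⟨hJ, hS⟩

lemma isTIdeal_tSpan (S : Set (FreeGraded K G)) : IsTIdeal (tSpan S) := by
  intro φ hφ f hf
  rw [← SetLike.mem_coe, tSpan, LieSubmodule.coe_sInf, Set.mem_iInter₂] at hf ⊢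
  exact fun J hJ => hJ.1 φ hφ f (hf J hJ)

lemma IsTIdeal.sup {I J : LieIdeal K (FreeGraded K G)} (hI : IsTIdeal I) (hJ : IsTIdeal J) :
    IsTIdeal (I ⊔ J) := by
  intro φ hφ f hf
  obtain ⟨a, ha, b, hb, rfl⟩ := (LieSubmodule.mem_sup _ _ _).1 hf
  rw [map_add]
  exact (LieSubmodule.mem_sup _ _ _).2 ⟨_, hI φ hφ a ha, _, hJ φ hφ b hb, rfl⟩

end Substitutions

/-! ### Values of the variables in upper triangular matrices -/

section Evaluation

variable {K : Type u} [Field K] {G : Type v}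

/-- The matrix of the value of `ψ`. -/
noncomputable def mat (ψ : FreeGraded K G →ₗ⁅K⁆ UT3 K) (f : FreeGraded K G) : Matrix (Fin 3) (Fin 3) K := ψ f

@[simp] lemma mat_zero (ψ : FreeGraded K G →ₗ⁅K⁆ UT3 K) : mat ψ 0 = 0 := by
  simp [mat]

@[simp] lemma mat_add (ψ : FreeGraded K G →ₗ⁅K⁆ UT3 K) (f g : FreeGraded K G) :
    mat ψ (f + g) = mat ψ f + mat ψ g := by
  simp [mat]

@[simp] lemma mat_sub (ψ : FreeGraded K G →ₗ⁅K⁆ UT3 K) (f g : FreeGraded K G) :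
    mat ψ (f - g) = mat ψ f - mat ψ g := by
  simp [mat]

@[simp] lemma mat_smul (ψ : FreeGraded K G →ₗ⁅K⁆ UT3 K) (c : K) (f : FreeGraded K G) :
    mat ψ (c • f) = c • mat ψ f := by
  simp [mat]

lemma mat_lie (ψ : FreeGraded K G →ₗ⁅K⁆ UT3 K) (f g : FreeGraded K G) :
    mat ψ ⁅f, g⁆ = mat ψ f * mat ψ g - mat ψ g * mat ψ f := by
  simp [mat, LieRing.of_associative_ring_bracket]

lemma mat_comp (ψ : FreeGraded K G →ₗ⁅K⁆ UT3 K) (φ : FreeGraded K G →ₗ⁅K⁆ FreeGraded K G)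
    (f : FreeGraded K G) : mat (ψ.comp φ) f = mat ψ (φ f) := rfl

variable [AddCommGroup G] {e₁ e₂ : G}

/-- Graded homomorphisms to `UT_3^{(-)}` with the grading `Γ(e₁, e₂)`. -/
abbrev IsEval (e₁ e₂ : G) (ψ : FreeGraded K G →ₗ⁅K⁆ UT3 K) : Prop :=
  IsGradedHom (freeComponent K) (elementaryComponent K e₁ e₂) ψ

/-- The ideal of graded identities of `UT_3^{(-)}` with the grading `Γ(e₁, e₂)`. -/
noncomputable abbrev idUT (K : Type u) [Field K] (e₁ e₂ : G) : LieIdeal K (FreeGraded K G) :=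
  gradedId (elementaryComponent K e₁ e₂)

lemma mem_idUT {f : FreeGraded K G} :
    f ∈ idUT K e₁ e₂ ↔ ∀ ψ, IsEval e₁ e₂ ψ → mat ψ f = 0 :=
  forall₂_congr fun ψ _ => (ZeroMemClass.coe_eq_zero (x := ψ f)).symm

lemma mat_gvar_apply {ψ : FreeGraded K G →ₗ⁅K⁆ UT3 K} (hψ : IsEval e₁ e₂ ψ) (i : ℕ) {g : G}
    {a b : Fin 3} (h : b < a ∨ unitDegree e₁ e₂ a b ≠ g) : mat ψ (gvar K i g) a b = 0 := by
  rcases h with h | h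
  · exact (ψ (gvar K i g)).2 a b h
  · by_contra h0
    exact h (hψ g _ (gvar_mem_freeComponent i g) a b h0)

/-- The degrees `0, e₁, e₂, e₁ + e₂` are pairwise distinct. -/
structure Distinct (e₁ e₂ : G) : Prop where
  fst_ne : e₁ ≠ 0
  snd_ne : e₂ ≠ 0
  ne : e₁ ≠ e₂
  add_ne : e₁ + e₂ ≠ 0

lemma mat_gvar_zero_apply (he : Distinct e₁ e₂)
    {ψ : FreeGraded K G →ₗ⁅K⁆ UT3 K} (hψ : IsEval e₁ e₂ ψ) (j : ℕ)
    {a b : Fin 3} (h : a ≠ b) : mat ψ (gvar K j (0 : G)) a b = 0 := by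
  apply mat_gvar_apply hψ
  obtain ⟨h1, h2, h3, h4⟩ := he
  fin_cases a <;> fin_cases b <;> simp_all [unitDegree]

lemma mat_lie_gvar_zero (he : Distinct e₁ e₂)
    {ψ : FreeGraded K G →ₗ⁅K⁆ UT3 K} (hψ : IsEval e₁ e₂ ψ) (j : ℕ)
    (f : FreeGraded K G) (a b : Fin 3) :
    mat ψ ⁅gvar K j (0 : G), f⁆ a b =
      (mat ψ (gvar K j (0 : G)) a a - mat ψ (gvar K j (0 : G)) b b) * mat ψ f a b := by
  have h : mat ψ (gvar K j (0 : G)) = Matrix.diagonal fun a => mat ψ (gvar K j (0 : G)) a a := by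
    ext a b
    by_cases hab : a = b
    · simp [hab]
    · rw [mat_gvar_zero_apply he hψ j hab, Matrix.diagonal_apply_ne _ hab]
  rw [mat_lie, h, Matrix.sub_apply, Matrix.diagonal_mul, Matrix.mul_diagonal]
  simp only [Matrix.diagonal_apply_eq]
  ring

lemma mat_gvar_fst (he : Distinct e₁ e₂)
    {ψ : FreeGraded K G →ₗ⁅K⁆ UT3 K} (hψ : IsEval e₁ e₂ ψ) (i : ℕ) :
    mat ψ (gvar K i e₁) = Matrix.single 0 1 (mat ψ (gvar K i e₁) 0 1) := by
  obtain ⟨h1, h2, h3, h4⟩ := he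
  ext a b
  by_cases hab : a = 0 ∧ b = 1
  · simp [hab]
  · rw [mat_gvar_apply hψ, Matrix.single_apply, if_neg (fun h => hab ⟨h.1.symm, h.2.symm⟩)]
    fin_cases a <;> fin_cases b <;> simp_all [unitDegree, eq_comm]

lemma mat_gvar_snd (he : Distinct e₁ e₂)
    {ψ : FreeGraded K G →ₗ⁅K⁆ UT3 K} (hψ : IsEval e₁ e₂ ψ) (i : ℕ) :
    mat ψ (gvar K i e₂) = Matrix.single 1 2 (mat ψ (gvar K i e₂) 1 2) := by
  obtain ⟨h1, h2, h3, h4⟩ := he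
  ext a b
  by_cases hab : a = 1 ∧ b = 2
  · simp [hab]
  · rw [mat_gvar_apply hψ, Matrix.single_apply, if_neg (fun h => hab ⟨h.1.symm, h.2.symm⟩)]
    fin_cases a <;> fin_cases b <;> simp_all [unitDegree, eq_comm]

lemma mat_gvar_corner (he : Distinct e₁ e₂)
    {ψ : FreeGraded K G →ₗ⁅K⁆ UT3 K} (hψ : IsEval e₁ e₂ ψ) (i : ℕ) :
    mat ψ (gvar K i (e₁ + e₂)) = Matrix.single 0 2 (mat ψ (gvar K i (e₁ + e₂)) 0 2) := by
  obtain ⟨h1, h2, h3, h4⟩ := he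
  ext a b
  by_cases hab : a = 0 ∧ b = 2
  · simp [hab]
  · rw [mat_gvar_apply hψ, Matrix.single_apply, if_neg (fun h => hab ⟨h.1.symm, h.2.symm⟩)]
    fin_cases a <;> fin_cases b <;> simp_all [unitDegree, eq_comm]

lemma gvar_mem_idUT (i : ℕ) {g : G} (h0 : g ≠ 0) (h1 : g ≠ e₁) (h2 : g ≠ e₂)
    (h3 : g ≠ e₁ + e₂) : gvar K i g ∈ idUT K e₁ e₂ := by
  rw [mem_idUT]
  intro ψ hψ
  ext a b
  rw [mat_gvar_apply hψ, Matrix.zero_apply]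
  fin_cases a <;> fin_cases b <;> simp_all [unitDegree, eq_comm]

end Evaluation

/-! ### Decomposition of the free algebra modulo identities -/

section Components

variable {K : Type u} [Field K] {G : Type v} [AddCommGroup G] {e₁ e₂ : G}

/-- Labels of the components of the relatively free algebra, according to which variables of
nonzero degree occur: none, `x_{i,e₁}`, `x_{i,e₂}`, `x_{i,e₁+e₂}`, or `x_{i,e₁}` and `x_{k,e₂}`. -/
inductive Label
  | diag
  | fst (i : ℕ)
  | snd (i : ℕ)
  | corner (i : ℕ)
  | mixed (i k : ℕ)

namespace Label

/-- Row of the matrix entry in which a component is supported. -/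
def row : Label → Fin 3
  | diag => 0
  | fst _ => 0
  | snd _ => 1
  | corner _ => 0
  | mixed _ _ => 0

/-- Column of the matrix entry in which a component is supported. -/
def col : Label → Fin 3
  | diag => 0
  | fst _ => 1
  | snd _ => 2
  | corner _ => 2
  | mixed _ _ => 2

/-- The same kind of component, with variables of index zero. -/
def base : Label → Label
  | diag => diag
  | fst _ => fst 0
  | snd _ => snd 0
  | corner _ => corner 0
  | mixed _ _ => mixed 0 0

/-- The value under `ψ` of the multilinear part of a component. -/
noncomputable def coef (e₁ e₂ : G) (ψ : FreeGraded K G →ₗ⁅K⁆ UT3 K) : Label → K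
  | diag => 0
  | fst i => mat ψ (gvar K i e₁) 0 1
  | snd i => mat ψ (gvar K i e₂) 1 2
  | corner i => mat ψ (gvar K i (e₁ + e₂)) 0 2
  | mixed i k => mat ψ (gvar K i e₁) 0 1 * mat ψ (gvar K k e₂) 1 2

/-- The difference of two diagonal entries of the value of `x_{j,0}`. -/
noncomputable def root (ψ : FreeGraded K G →ₗ⁅K⁆ UT3 K) (a b : Fin 3) (j : ℕ) : K :=
  mat ψ (gvar K j (0 : G)) a a - mat ψ (gvar K j (0 : G)) b b

/-- The point at which the polynomial parts of a component are evaluated. -/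
noncomputable def pt (ψ : FreeGraded K G →ₗ⁅K⁆ UT3 K) : Label → VarIdx → K
  -- Only mixed components distinguish the two variables of index `j`; elsewhere both take the same
  -- value. The polynomial of an element need not be unique, and only its existence matters.
  | mixed _ _, x => bif (ofLex (OrderDual.ofDual x)).2
      then root ψ 1 2 (ofLex (OrderDual.ofDual x)).1 else root ψ 0 1 (ofLex (OrderDual.ofDual x)).1
  | ℓ, x => root ψ ℓ.row ℓ.col (ofLex (OrderDual.ofDual x)).1

/-- The variables of nonzero degree occurring in a component. -/
def supp (e₁ e₂ : G) : Label → Set (ℕ × G)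
  | diag => ∅
  | fst i => {(i, e₁)}
  | snd i => {(i, e₂)}
  | corner i => {(i, e₁ + e₂)}
  | mixed i k => {(i, e₁), (k, e₂)}

lemma finite_supp (ℓ : Label) : (ℓ.supp e₁ e₂).Finite := by
  cases ℓ <;> simp [supp]

lemma supp_injective (he : Distinct e₁ e₂) : Function.Injective (supp e₁ e₂) := by
  obtain ⟨h1, h2, h3, h4⟩ := he
  have h5 : e₁ ≠ e₁ + e₂ := by simpa using h2
  have h6 : e₂ ≠ e₁ + e₂ := by simpa using h1
  intro ℓ ℓ' h
  have a1 := fun n => Set.ext_iff.1 h (n, e₁)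
  have a2 := fun n => Set.ext_iff.1 h (n, e₂)
  have a3 := fun n => Set.ext_iff.1 h (n, e₁ + e₂)
  clear h
  cases ℓ <;> cases ℓ' <;> simp [supp, h1, h2, h3, h3.symm] at a1 a2 a3 <;> simp_all

/-- The polynomial by which bracketing with `x_{j,0}` acts on a component. -/
noncomputable def adPoly (K : Type u) [Field K] (j : ℕ) : Label → MvPolynomial VarIdx K
  -- The difference for the entry `(0, 2)` is the sum of those for `(0, 1)` and `(1, 2)`.
  | mixed _ _ => MvPolynomial.X (vidx j false) + MvPolynomial.X (vidx j true)
  | _ => MvPolynomial.X (vidx j false)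

lemma eval_adPoly (ψ : FreeGraded K G →ₗ⁅K⁆ UT3 K) (j : ℕ) (ℓ : Label) :
    MvPolynomial.eval (ℓ.pt ψ) (ℓ.adPoly K j) = root ψ ℓ.row ℓ.col j := by
  cases ℓ <;> simp [adPoly, pt, row, col, root, vidx]

end Label

open Label

/-- `f` takes the values prescribed by the label `ℓ` and the polynomial `p`. -/
def HasPoly (e₁ e₂ : G) (ℓ : Label) (p : MvPolynomial VarIdx K) (f : FreeGraded K G) : Prop :=
  ∀ ψ, IsEval e₁ e₂ ψ → mat ψ f =
    Matrix.single ℓ.row ℓ.col (ℓ.coef e₁ e₂ ψ * MvPolynomial.eval (ℓ.pt ψ) p)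

namespace HasPoly

variable {ℓ : Label} {p q : MvPolynomial VarIdx K} {f g : FreeGraded K G}

lemma zero : HasPoly e₁ e₂ ℓ (0 : MvPolynomial VarIdx K) 0 := by
  intro ψ _; simp

lemma add (hf : HasPoly e₁ e₂ ℓ p f) (hg : HasPoly e₁ e₂ ℓ q g) :
    HasPoly e₁ e₂ ℓ (p + q) (f + g) := by
  intro ψ hψ
  rw [mat_add, hf ψ hψ, hg ψ hψ, map_add, mul_add, Matrix.single_add]

lemma smul (hf : HasPoly e₁ e₂ ℓ p f) (c : K) :
    HasPoly e₁ e₂ ℓ (MvPolynomial.C c * p) (c • f) := by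
  intro ψ hψ
  rw [mat_smul, hf ψ hψ, map_mul, MvPolynomial.eval_C, Matrix.smul_single, smul_eq_mul,
    mul_left_comm]

lemma sub_mem (hf : HasPoly e₁ e₂ ℓ p f) (hg : HasPoly e₁ e₂ ℓ p g) : f - g ∈ idUT K e₁ e₂ := by
  rw [mem_idUT]
  intro ψ hψ
  rw [mat_sub, hf ψ hψ, hg ψ hψ, sub_self]

lemma of_mem (hf : f ∈ idUT K e₁ e₂) : HasPoly e₁ e₂ ℓ (0 : MvPolynomial VarIdx K) f := by
  intro ψ hψ
  rw [mem_idUT.1 hf ψ hψ]; simp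

lemma lie_gvar (he : Distinct e₁ e₂) (hf : HasPoly e₁ e₂ ℓ p f) (j : ℕ) :
    HasPoly e₁ e₂ ℓ (ℓ.adPoly K j * p) ⁅gvar K j (0 : G), f⁆ := by
  intro ψ hψ
  ext a b
  rw [mat_lie_gvar_zero he hψ, hf ψ hψ, map_mul, eval_adPoly]
  simp only [Matrix.single_apply]
  split_ifs with h
  · rw [← h.1, ← h.2, root]; ring
  · simp

/-- Transport along a substitution. -/
lemma map {ℓ' : Label} {φ : FreeGraded K G →ₗ⁅K⁆ FreeGraded K G}
    (hφ : IsGradedHom (freeComponent K) (freeComponent K) φ) (hf : HasPoly e₁ e₂ ℓ p f)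
    (hr : ℓ.row = ℓ'.row) (hc : ℓ.col = ℓ'.col)
    (h : ∀ ψ : FreeGraded K G →ₗ⁅K⁆ UT3 K, IsEval e₁ e₂ ψ →
      ℓ.coef e₁ e₂ (ψ.comp φ) * MvPolynomial.eval (ℓ.pt (ψ.comp φ)) p =
        ℓ'.coef e₁ e₂ ψ * MvPolynomial.eval (ℓ'.pt ψ) q) :
    HasPoly e₁ e₂ ℓ' q (φ f) := by
  intro ψ hψ
  rw [← mat_comp, hf _ (hψ.comp hφ), h ψ hψ, hr, hc]

end HasPoly

/-- The component with a given label. -/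
noncomputable def component (K : Type u) [Field K] (e₁ e₂ : G) :
    Label → Submodule K (FreeGraded K G)
  | .diag => Submodule.span K (Set.range fun j => gvar K j (0 : G))
  | ℓ =>
    { carrier := {f | ∃ p : MvPolynomial VarIdx K, HasPoly e₁ e₂ ℓ p f}
      add_mem' := fun ⟨_, hp⟩ ⟨_, hq⟩ => ⟨_, hp.add hq⟩
      zero_mem' := ⟨_, HasPoly.zero⟩
      smul_mem' := fun c _ ⟨_, hp⟩ => ⟨_, hp.smul c⟩ }

lemma mem_component {ℓ : Label} (hℓ : ℓ ≠ .diag) {f : FreeGraded K G} :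
    f ∈ component K e₁ e₂ ℓ ↔ ∃ p : MvPolynomial VarIdx K, HasPoly e₁ e₂ ℓ p f := by
  cases ℓ
  · exact absurd rfl hℓ
  all_goals rfl

lemma idUT_le {f : FreeGraded K G} (hf : f ∈ idUT K e₁ e₂) : f ∈ ⨆ ℓ, component K e₁ e₂ ℓ :=
  -- Every component other than `diag` contains the identities, with polynomial zero; `fst 0` is an
  -- arbitrary choice.
  Submodule.mem_iSup_of_mem (.fst 0) ⟨0, HasPoly.of_mem hf⟩

lemma lie_gvar_zero_mem (he : Distinct e₁ e₂) (i : ℕ) {ℓ : Label} {f : FreeGraded K G}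
    (hf : f ∈ component K e₁ e₂ ℓ) :
    ⁅gvar K i (0 : G), f⁆ ∈ ⨆ ℓ, component K e₁ e₂ ℓ := by
  by_cases hℓ : ℓ = .diag
  · subst hℓ
    refine idUT_le ?_
    induction hf using Submodule.span_induction with
    | mem x hx =>
      obtain ⟨j, rfl⟩ := hx
      rw [mem_idUT]
      intro ψ hψ
      ext a b
      rw [mat_lie_gvar_zero he hψ]
      by_cases hab : a = b
      · simp [hab]
      · simp [mat_gvar_zero_apply he hψ j hab]
    | zero => rw [lie_zero]; exact zero_mem _
    | add x y _ _ hx hy => rw [lie_add]; exact add_mem hx hy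
    | smul c x _ hx => rw [lie_smul]; exact (idUT K e₁ e₂).toSubmodule.smul_mem _ hx
  · obtain ⟨p, hp⟩ := (mem_component hℓ).1 hf
    exact Submodule.mem_iSup_of_mem ℓ ((mem_component hℓ).2 ⟨_, hp.lie_gvar he i⟩)

lemma lie_diag_mem (he : Distinct e₁ e₂) {ℓ : Label} {f g : FreeGraded K G}
    (hf : f ∈ component K e₁ e₂ .diag) (hg : g ∈ component K e₁ e₂ ℓ) :
    ⁅f, g⁆ ∈ ⨆ ℓ, component K e₁ e₂ ℓ := by
  induction hf using Submodule.span_induction with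
  | mem x hx =>
    obtain ⟨j, rfl⟩ := hx
    exact lie_gvar_zero_mem he j hg
  | zero => rw [zero_lie]; exact zero_mem _
  | add x y _ _ hx hy => rw [add_lie]; exact add_mem hx hy
  | smul c x _ hx => rw [smul_lie]; exact Submodule.smul_mem _ _ hx

lemma lie_fst_snd_mem {i k : ℕ} {p q : MvPolynomial VarIdx K}
    {f g : FreeGraded K G} (hf : HasPoly e₁ e₂ (.fst i) p f) (hg : HasPoly e₁ e₂ (.snd k) q g) :
    ⁅f, g⁆ ∈ component K e₁ e₂ (.mixed i k) := by
  refine ⟨MvPolynomial.rename (fun x => vidx (ofLex (OrderDual.ofDual x)).1 false) p *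
    MvPolynomial.rename (fun x => vidx (ofLex (OrderDual.ofDual x)).1 true) q, fun ψ hψ => ?_⟩
  rw [mat_lie, hf ψ hψ, hg ψ hψ, map_mul, MvPolynomial.eval_rename, MvPolynomial.eval_rename]
  have h1 : (Label.mixed i k).pt ψ ∘ (fun x => vidx (ofLex (OrderDual.ofDual x)).1 false) =
      (Label.fst i).pt ψ := rfl
  have h2 : (Label.mixed i k).pt ψ ∘ (fun x => vidx (ofLex (OrderDual.ofDual x)).1 true) =
      (Label.snd k).pt ψ := rfl
  rw [h1, h2]
  simp only [row, col, coef]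
  rw [Matrix.single_mul_single_same, Matrix.single_mul_single_of_ne _ _ _ _ (by decide), sub_zero]
  congr 1
  ring

lemma lie_mem_iSup_component (he : Distinct e₁ e₂) {ℓ ℓ' : Label} {f g : FreeGraded K G}
    (hf : f ∈ component K e₁ e₂ ℓ) (hg : g ∈ component K e₁ e₂ ℓ') :
    ⁅f, g⁆ ∈ ⨆ ℓ, component K e₁ e₂ ℓ := by
  have skew : ∀ {f g : FreeGraded K G}, ⁅g, f⁆ ∈ ⨆ ℓ, component K e₁ e₂ ℓ →
      ⁅f, g⁆ ∈ ⨆ ℓ, component K e₁ e₂ ℓ := fun h => by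
    rw [← lie_skew]; exact neg_mem h
  by_cases hℓ : ℓ = .diag
  · subst hℓ; exact lie_diag_mem he hf hg
  by_cases hℓ' : ℓ' = .diag
  · subst hℓ'; exact skew (lie_diag_mem he hg hf)
  obtain ⟨p, hp⟩ := (mem_component hℓ).1 hf
  obtain ⟨q, hq⟩ := (mem_component hℓ').1 hg
  -- If both products of the matrix units vanish, the bracket is an identity. Among labels other
  -- than `diag`, only `fst` against `snd` escapes this.
  have comm : ℓ.col ≠ ℓ'.row → ℓ'.col ≠ ℓ.row → ⁅f, g⁆ ∈ ⨆ ℓ, component K e₁ e₂ ℓ := by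
    refine fun h1 h2 => idUT_le (mem_idUT.2 fun ψ hψ => ?_)
    rw [mat_lie, hp ψ hψ, hq ψ hψ, Matrix.single_mul_single_of_ne _ _ _ _ h1,
      Matrix.single_mul_single_of_ne _ _ _ _ h2, sub_zero]
  rcases ℓ with _ | i | i | i | ⟨i, k⟩ <;> rcases ℓ' with _ | i' | i' | i' | ⟨i', k'⟩ <;>
    first
    | exact absurd rfl hℓ
    | exact absurd rfl hℓ'
    | exact Submodule.mem_iSup_of_mem _ (lie_fst_snd_mem hp hq)
    | exact skew (Submodule.mem_iSup_of_mem _ (lie_fst_snd_mem hq hp))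
    | exact comm (by simp [row, col]) (by simp [row, col])

lemma gvar_mem_iSup_component (he : Distinct e₁ e₂) (i : ℕ) (g : G) :
    gvar K i g ∈ ⨆ ℓ, component K e₁ e₂ ℓ := by
  by_cases h0 : g = 0
  · subst h0
    exact Submodule.mem_iSup_of_mem .diag (Submodule.subset_span ⟨i, rfl⟩)
  by_cases h1 : g = e₁
  · subst h1
    exact Submodule.mem_iSup_of_mem (.fst i)
      ⟨1, fun ψ hψ => by rw [mat_gvar_fst he hψ, map_one, mul_one]; rfl⟩
  by_cases h2 : g = e₂
  · subst h2
    exact Submodule.mem_iSup_of_mem (.snd i)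
      ⟨1, fun ψ hψ => by rw [mat_gvar_snd he hψ, map_one, mul_one]; rfl⟩
  by_cases h3 : g = e₁ + e₂
  · subst h3
    exact Submodule.mem_iSup_of_mem (.corner i)
      ⟨1, fun ψ hψ => by rw [mat_gvar_corner he hψ, map_one, mul_one]; rfl⟩
  exact idUT_le (gvar_mem_idUT i h0 h1 h2 h3)

/-- The sum is a Lie subalgebra containing all variables, so the lift of the variables to it,
followed by the inclusion, is the identity. -/
lemma iSup_component (he : Distinct e₁ e₂) : ⨆ ℓ, component K e₁ e₂ ℓ = ⊤ := by
  let N : LieSubalgebra K (FreeGraded K G) :=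
    { (⨆ ℓ, component K e₁ e₂ ℓ : Submodule K (FreeGraded K G)) with
      lie_mem' := fun {f g} hf hg => by
        change f ∈ ⨆ ℓ, component K e₁ e₂ ℓ at hf
        change g ∈ ⨆ ℓ, component K e₁ e₂ ℓ at hg
        change ⁅f, g⁆ ∈ ⨆ ℓ, component K e₁ e₂ ℓ
        induction hf using Submodule.iSup_induction' with
        | mem ℓ f hf =>
          induction hg using Submodule.iSup_induction' with
          | mem ℓ' g hg => exact lie_mem_iSup_component he hf hg
          | zero => rw [lie_zero]; exact zero_mem _
          | add x y _ _ hx hy => rw [lie_add]; exact add_mem hx hy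
        | zero => rw [zero_lie]; exact zero_mem _
        | add x y _ _ hx hy => rw [add_lie]; exact add_mem hx hy }
  let φ : FreeGraded K G →ₗ⁅K⁆ N := FreeLieAlgebra.lift K
    fun x => ⟨gvar K x.1 x.2, gvar_mem_iSup_component he x.1 x.2⟩
  have hφ : N.incl.comp φ = LieHom.id := by
    apply FreeLieAlgebra.hom_ext
    intro x
    simp [φ, gvar]
  refine eq_top_iff.2 fun f _ => ?_
  have := (φ f).2
  rwa [show ((φ f : N) : FreeGraded K G) = f from LieHom.congr_fun hφ f] at this

-- All variables that affect the values of `f` are kept, so the values do not change.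
open Classical in
lemma keep_sub_mem {ℓ : Label} {f : FreeGraded K G}
    (hf : f ∈ component K e₁ e₂ ℓ) {A : Set (ℕ × G)} (hA : ℓ.supp e₁ e₂ ⊆ A) :
    keep (fun i g => g = 0 ∨ (i, g) ∈ A) f - f ∈ idUT K e₁ e₂ := by
  by_cases hℓ : ℓ = .diag
  · subst hℓ
    suffices keep (fun i g => g = 0 ∨ (i, g) ∈ A) f = f by rw [this, sub_self]; exact zero_mem _
    induction hf using Submodule.span_induction with
    | mem x hx => obtain ⟨j, rfl⟩ := hx; simp [keep]
    | zero => rw [map_zero]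
    | add x y _ _ hx hy => rw [map_add, hx, hy]
    | smul c x _ hx => rw [map_smul, hx]
  · obtain ⟨p, hp⟩ := (mem_component hℓ).1 hf
    refine HasPoly.sub_mem (ℓ := ℓ) (p := p)
      (hp.map (isGradedHom_keep _) rfl rfl fun ψ hψ => ?_) hp
    have h0 : ∀ a b, root (ψ.comp (keep fun i g => g = 0 ∨ (i, g) ∈ A)) a b = root ψ a b := by
      intro a b; ext j; simp [root, mat_comp, keep]
    have h1 : ∀ i g, (i, g) ∈ A →
      mat (ψ.comp (keep fun i g => g = 0 ∨ (i, g) ∈ A)) (gvar K i g) = mat ψ (gvar K i g) := by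
      intro i g h; simp [mat_comp, keep, h]
    congr 1
    · rcases ℓ with _ | i | i | i | ⟨i, k⟩ <;> simp [supp, Set.insert_subset_iff] at hA <;>
        simp [coef, h1, hA]
    · congr 2
      rcases ℓ with _ | i | i | i | ⟨i, k⟩ <;> (ext x; simp only [pt, h0])

-- A variable dividing the multilinear coefficient is sent to zero.
open Classical in
lemma keep_mem {ℓ : Label} {f : FreeGraded K G} (he : Distinct e₁ e₂)
    (hf : f ∈ component K e₁ e₂ ℓ) {A : Set (ℕ × G)} (hA : ¬ ℓ.supp e₁ e₂ ⊆ A) :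
    keep (fun i g => g = 0 ∨ (i, g) ∈ A) f ∈ idUT K e₁ e₂ := by
  obtain ⟨h01, h02, -, h03⟩ := he
  have hℓ : ℓ ≠ .diag := by rintro rfl; simp [supp] at hA
  obtain ⟨p, hp⟩ := (mem_component hℓ).1 hf
  rw [mem_idUT]
  intro ψ hψ
  have h1 : ∀ i g, g ≠ 0 → (i, g) ∉ A →
      mat (ψ.comp (keep fun i g => g = 0 ∨ (i, g) ∈ A)) (gvar K i g) = 0 := by
    intro i g hg h; simp [mat_comp, keep, h, hg]
  rw [← mat_comp, hp _ (hψ.comp (isGradedHom_keep _))]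
  have : ℓ.coef e₁ e₂ (ψ.comp (keep fun i g => g = 0 ∨ (i, g) ∈ A)) = 0 := by
    rcases ℓ with _ | i | i | i | ⟨i, k⟩
    · rfl
    · simp [coef, h1 i e₁ h01 (by simpa [supp] using hA)]
    · simp [coef, h1 i e₂ h02 (by simpa [supp] using hA)]
    · simp [coef, h1 i (e₁ + e₂) h03 (by simpa [supp] using hA)]
    · by_cases hi : (i, e₁) ∈ A
      · have hk : (k, e₂) ∉ A := by simpa [supp, Set.insert_subset_iff, hi] using hA
        simp [coef, h1 k e₂ h02 hk]
      · simp [coef, h1 i e₁ h01 hi]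
  simp [this]

/-- The components of an element of a `T`-ideal lie in the `T`-ideal. -/
lemma component_mem (he : Distinct e₁ e₂) {J : LieIdeal K (FreeGraded K G)} (hJ : IsTIdeal J)
    (hId : idUT K e₁ e₂ ≤ J) (f : Label →₀ FreeGraded K G)
    (hf : ∀ ℓ, f ℓ ∈ component K e₁ e₂ ℓ) (hs : (f.sum fun _ x => x) ∈ J) (ℓ : Label) :
    f ℓ ∈ J := by
  classical
  -- Keeping only the variables of `ℓ` and those of degree zero kills, modulo identities, every
  -- component whose support is not inside that of `ℓ`. The other components that survive have
  -- strictly smaller support and lie in `J` by induction.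
  induction h : (ℓ.supp e₁ e₂).ncard using Nat.strong_induction_on generalizing ℓ with
  | _ n ih =>
  subst h
  by_cases hℓ : ℓ ∈ f.support
  swap
  · rw [Finsupp.notMem_support_iff.1 hℓ]; exact zero_mem _
  have h1 := hJ _ (isGradedHom_keep fun i g => g = 0 ∨ (i, g) ∈ ℓ.supp e₁ e₂) _ hs
  rw [Finsupp.sum, map_sum, ← Finset.add_sum_erase _ _ hℓ] at h1
  have h2 : ∑ x ∈ f.support.erase ℓ,
      keep (fun i g => g = 0 ∨ (i, g) ∈ ℓ.supp e₁ e₂) (f x) ∈ J := by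
    refine sum_mem fun m hm => ?_
    by_cases hsub : m.supp e₁ e₂ ⊆ ℓ.supp e₁ e₂
    · have hne : m.supp e₁ e₂ ≠ ℓ.supp e₁ e₂ := fun h =>
        (Finset.mem_erase.1 hm).1 (supp_injective he h)
      have hlt := Set.ncard_lt_ncard (hsub.ssubset_of_ne hne) ℓ.finite_supp
      simpa using add_mem (hId (keep_sub_mem (hf m) hsub)) (ih _ hlt m rfl)
    · exact hId (keep_mem he (hf m) hsub)
  have h3 := sub_mem (sub_mem h1 h2) (hId (keep_sub_mem (hf ℓ) (A := ℓ.supp e₁ e₂) subset_rfl))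
  simpa using h3

end Components

/-! ### Polynomial ideals of T-ideals and finite generation -/

section FiniteGeneration

variable {K : Type u} [Field K] {G : Type v}

lemma mat_comp_renameVar (ψ : FreeGraded K G →ₗ⁅K⁆ UT3 K) (r : G → ℕ → ℕ) (i : ℕ) (g : G) :
    mat (ψ.comp (renameVar r)) (gvar K i g) = mat ψ (gvar K (r g i) g) := by
  rw [mat_comp, renameVar, subst_gvar]

variable [AddCommGroup G] {e₁ e₂ : G}

open Label

/-- The degree of the variable whose bracket with `x_{j,0}` multiplies the polynomial part of a
component by `X (j, b)`. -/
def Label.adDegree (e₁ e₂ : G) : Label → Bool → G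
  | diag, _ => 0
  | fst _, _ => e₁
  | snd _, _ => e₂
  | corner _, _ => e₁ + e₂
  | mixed _ _, b => bif b then e₂ else e₁

lemma Distinct.fst_ne_add (he : Distinct e₁ e₂) : e₁ ≠ e₁ + e₂ := by simpa using he.snd_ne

lemma Distinct.snd_ne_add (he : Distinct e₁ e₂) : e₂ ≠ e₁ + e₂ := by simpa using he.fst_ne

/-- The substitution scales one factor of the multilinear coefficient and fixes the degree-zero
variables, hence the evaluation point. In a mixed component it isolates a single `X (j, b)`, whereas
bracketing the whole element yields only the sum of the two. -/
lemma HasPoly.X_mul (he : Distinct e₁ e₂) {ℓ : Label} {p : MvPolynomial VarIdx K}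
    {f : FreeGraded K G} (hf : HasPoly e₁ e₂ ℓ p f) (hℓ : ℓ ≠ .diag) (j : ℕ) (b : Bool) :
    HasPoly e₁ e₂ ℓ (MvPolynomial.X (vidx j b) * p) (adVar (ℓ.adDegree e₁ e₂ b) j f) := by
  have hγ : ℓ.adDegree e₁ e₂ b ≠ 0 := by
    cases ℓ <;> cases b <;> simp [adDegree, he.fst_ne, he.snd_ne, he.add_ne] <;> simp at hℓ
  have h := he.ne
  have h0 := he.fst_ne_add
  have h1 := he.snd_ne_add
  refine hf.map (isGradedHom_adVar _ _) rfl rfl fun ψ hψ => ?_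
  have hpt : ℓ.pt (ψ.comp (adVar (ℓ.adDegree e₁ e₂ b) j)) = ℓ.pt ψ := by
    have h0 : ∀ c d, root (ψ.comp (adVar (ℓ.adDegree e₁ e₂ b) j)) c d = root ψ c d := by
      intro c d; ext i; simp [root, mat_comp, adVar, hγ.symm]
    cases ℓ <;> (ext x; simp only [pt, h0])
  have hcoef : ℓ.coef e₁ e₂ (ψ.comp (adVar (ℓ.adDegree e₁ e₂ b) j)) =
      ℓ.pt ψ (vidx j b) * ℓ.coef e₁ e₂ ψ := by
    cases ℓ <;> cases b <;>
      simp [coef, mat_comp, adVar, adDegree, pt, row, col, vidx, mat_lie_gvar_zero he hψ,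
        h, h.symm, root] <;> ring
  rw [hpt, hcoef, map_mul, MvPolynomial.eval_X]
  ring

lemma HasPoly.renameVar {ℓ ℓ' : Label} {p q : MvPolynomial VarIdx K} {f : FreeGraded K G}
    (hf : HasPoly e₁ e₂ ℓ p f) (r : G → ℕ → ℕ) (hr : ℓ.row = ℓ'.row) (hc : ℓ.col = ℓ'.col)
    (hcoef : ∀ ψ : FreeGraded K G →ₗ⁅K⁆ UT3 K,
      ℓ.coef e₁ e₂ (ψ.comp (renameVar r)) = ℓ'.coef e₁ e₂ ψ)
    (hpt : ∀ ψ : FreeGraded K G →ₗ⁅K⁆ UT3 K,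
      MvPolynomial.eval (ℓ.pt (ψ.comp (GradedLie.renameVar r))) p =
        MvPolynomial.eval (ℓ'.pt ψ) q) :
    HasPoly e₁ e₂ ℓ' q (GradedLie.renameVar r f) :=
  hf.map (isGradedHom_renameVar r) hr hc fun ψ _ => by rw [hcoef, hpt]

open Classical in
lemma HasPoly.shift (he : Distinct e₁ e₂) {ℓ : Label} {p : MvPolynomial VarIdx K}
    {f : FreeGraded K G} (hf : HasPoly e₁ e₂ ℓ p f) (π : ℕ → ℕ) :
    HasPoly e₁ e₂ ℓ (MvPolynomial.rename (shiftIdx π) p)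
      (GradedLie.renameVar (fun g i => if g = 0 then π i else i) f) := by
  refine hf.renameVar _ rfl rfl (fun ψ => ?_) fun ψ => ?_
  · cases ℓ <;> simp [coef, mat_comp_renameVar, he.fst_ne, he.snd_ne, he.add_ne]
  · rw [MvPolynomial.eval_rename]
    congr 2
    cases ℓ <;> (ext x; simp [pt, root, mat_comp_renameVar, shiftIdx, vidx])

open Classical in
lemma HasPoly.to_base (he : Distinct e₁ e₂) {ℓ : Label} {p : MvPolynomial VarIdx K}
    {f : FreeGraded K G} (hf : HasPoly e₁ e₂ ℓ p f) :
    HasPoly e₁ e₂ ℓ.base p (GradedLie.renameVar (fun g i => if g = 0 then i else 0) f) := by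
  refine hf.renameVar _ (by cases ℓ <;> rfl) (by cases ℓ <;> rfl) (fun ψ => ?_) fun ψ => ?_
  · cases ℓ <;> simp [coef, base, mat_comp_renameVar, he.fst_ne, he.snd_ne, he.add_ne]
  · congr 2
    cases ℓ <;> (ext x; simp [pt, row, col, base, root, mat_comp_renameVar])

lemma HasPoly.of_base (he : Distinct e₁ e₂) {ℓ : Label} {p : MvPolynomial VarIdx K}
    {f : FreeGraded K G} (hf : HasPoly e₁ e₂ ℓ.base p f) :
    ∃ r, HasPoly e₁ e₂ ℓ p (GradedLie.renameVar r f) := by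
  classical
  have h := he.ne
  -- The two variables of `mixed 0 0` share the index `0` but differ in degree, so a renaming
  -- depending on the degree can separate them.
  obtain ⟨a, b, hab⟩ : ∃ a b : ℕ, ∀ ψ : FreeGraded K G →ₗ⁅K⁆ UT3 K, ℓ.base.coef e₁ e₂ (ψ.comp
      (GradedLie.renameVar (fun g i => if g = 0 then i else if g = e₂ then b else a))) =
      ℓ.coef e₁ e₂ ψ := by
    rcases ℓ with _ | i | i | i | ⟨i, k⟩
    · exact ⟨0, 0, fun ψ => rfl⟩
    · exact ⟨i, i, fun ψ => by simp [coef, base, mat_comp_renameVar, he.fst_ne]⟩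
    · exact ⟨i, i, fun ψ => by simp [coef, base, mat_comp_renameVar, he.snd_ne]⟩
    · exact ⟨i, i, fun ψ => by simp [coef, base, mat_comp_renameVar, he.add_ne]⟩
    · exact ⟨i, k, fun ψ => by simp [coef, base, mat_comp_renameVar, he.fst_ne, he.snd_ne, h]⟩
  refine ⟨_, hf.renameVar _ (by cases ℓ <;> rfl) (by cases ℓ <;> rfl) hab fun ψ => ?_⟩
  congr 2
  cases ℓ <;> (ext x; simp [pt, row, col, base, root, mat_comp_renameVar])

/-- The polynomial parts of the elements of a `T`-ideal in a given component. -/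
def polyIdeal (he : Distinct e₁ e₂) {J : LieIdeal K (FreeGraded K G)} (hJ : IsTIdeal J)
    {ℓ : Label} (hℓ : ℓ ≠ .diag) : Ideal (MvPolynomial VarIdx K) where
  carrier := {p | ∃ f ∈ J, HasPoly e₁ e₂ ℓ p f}
  add_mem' := fun ⟨_, hf, hp⟩ ⟨_, hg, hq⟩ => ⟨_, add_mem hf hg, hp.add hq⟩
  zero_mem' := ⟨0, zero_mem _, HasPoly.zero⟩
  smul_mem' c p hp := by
    rw [smul_eq_mul]
    revert p
    induction c using MvPolynomial.induction_on with
    | C a =>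
      rintro p ⟨f, hf, hp⟩
      exact ⟨_, J.toSubmodule.smul_mem a hf, hp.smul a⟩
    | add c d hc hd =>
      intro p hp
      obtain ⟨f, hf, h⟩ := hc p hp
      obtain ⟨g, hg, h'⟩ := hd p hp
      rw [add_mul]
      exact ⟨_, add_mem hf hg, h.add h'⟩
    | mul_X c x hc =>
      rintro p ⟨f, hf, hp⟩
      -- Multiplication by a variable is realised by `adVar`, under which `J` is stable.
      rw [mul_assoc]
      exact hc _ ⟨_, hJ _ (isGradedHom_adVar _ _) f hf, hp.X_mul he hℓ _ _⟩

lemma mem_polyIdeal {he : Distinct e₁ e₂} {J : LieIdeal K (FreeGraded K G)} {hJ : IsTIdeal J}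
    {ℓ : Label} {hℓ : ℓ ≠ .diag} {p : MvPolynomial VarIdx K} :
    p ∈ polyIdeal he hJ hℓ ↔ ∃ f ∈ J, HasPoly e₁ e₂ ℓ p f := Iff.rfl

lemma shiftStable_polyIdeal (he : Distinct e₁ e₂) {J : LieIdeal K (FreeGraded K G)}
    (hJ : IsTIdeal J) {ℓ : Label} (hℓ : ℓ ≠ .diag) : ShiftStable (polyIdeal he hJ hℓ) := by
  rintro π - p ⟨f, hf, hp⟩
  exact ⟨_, hJ _ (isGradedHom_renameVar _) f hf, hp.shift he π⟩

/-- `S` controls the component `ℓ` of the `T`-ideal `J`. -/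
def Controls (J : LieIdeal K (FreeGraded K G)) (e₁ e₂ : G) (ℓ : Label)
    (S : Finset (FreeGraded K G)) : Prop :=
  (S : Set (FreeGraded K G)) ⊆ J ∧ ∀ J' : LieIdeal K (FreeGraded K G), IsTIdeal J' →
    idUT K e₁ e₂ ≤ J' → (S : Set (FreeGraded K G)) ⊆ J' →
      ∀ f ∈ J, f ∈ component K e₁ e₂ ℓ → f ∈ J'

lemma exists_controls_base (he : Distinct e₁ e₂) {J : LieIdeal K (FreeGraded K G)}
    (hJ : IsTIdeal J) {ℓ : Label} (hℓ : ℓ ≠ .diag) :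
    ∃ S : Finset (FreeGraded K G), ∀ ℓ' : Label, ℓ'.base = ℓ → Controls J e₁ e₂ ℓ' S := by
  classical
  obtain ⟨F, hF, hgen⟩ := exists_finset_of_shiftStable (polyIdeal he hJ hℓ)
    (shiftStable_polyIdeal he hJ hℓ)
  choose! lift hlift hpoly using fun p hp => mem_polyIdeal.1 (hF p hp)
  have hS : (F.image lift : Set (FreeGraded K G)) ⊆ J := by
    rw [Finset.coe_image]
    rintro _ ⟨p, hp, rfl⟩
    exact hlift p hp
  refine ⟨F.image lift, fun ℓ' hb => ⟨hS, fun J' hJ' hId hS' f hf hfc => ?_⟩⟩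
  subst hb
  have hℓ' : ℓ' ≠ .diag := by rintro rfl; exact hℓ rfl
  obtain ⟨p, hp⟩ := (mem_component hℓ').1 hfc
  -- The lifts of `F` lie in `J'`, so the polynomial ideal of `J'` contains `F` and, being
  -- shift-stable, the whole polynomial ideal of `J`.
  have hle : polyIdeal he hJ hℓ ≤ polyIdeal he hJ' hℓ :=
    hgen _ (shiftStable_polyIdeal he hJ' hℓ) fun p hp =>
      ⟨lift p, hS' (Finset.mem_coe.2 (Finset.mem_image_of_mem _ hp)), hpoly p hp⟩
  obtain ⟨g, hg, hgp⟩ := hle ⟨_, hJ _ (isGradedHom_renameVar _) f hf, hp.to_base he⟩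
  obtain ⟨r, hr⟩ := hgp.of_base he
  -- After renaming back, the element of `J'` has the same polynomial as `f`, so the two differ by
  -- an identity.
  have := add_mem (hId (hp.sub_mem hr)) (hJ' _ (isGradedHom_renameVar r) g hg)
  simpa using this

/-- The component of degree zero is controlled by at most one variable: if a `T`-ideal contains a
nontrivial linear combination of variables of degree zero, then it contains all of them. -/
lemma exists_controls_diag {J : LieIdeal K (FreeGraded K G)} (hJ : IsTIdeal J) :
    ∃ S : Finset (FreeGraded K G), Controls J e₁ e₂ .diag S := by
  classical
  by_cases h0 : gvar K 0 (0 : G) ∈ J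
  · refine ⟨{gvar K 0 0}, by simpa using h0, fun J' hJ' _ hS f _ hfc => ?_⟩
    refine (Submodule.span_le (p := J'.toSubmodule)).2 ?_ hfc
    rintro _ ⟨j, rfl⟩
    have := hJ' _ (isGradedHom_renameVar fun _ _ => j) _ (hS (by simp) : gvar K 0 (0 : G) ∈ J')
    simpa [renameVar] using this
  · refine ⟨∅, by simp, fun J' hJ' _ _ f hf hfc => ?_⟩
    obtain ⟨c, rfl⟩ := (Finsupp.mem_span_range_iff_exists_finsupp).1 hfc
    suffices c = 0 by subst this; simp
    by_contra hc
    obtain ⟨j, hj⟩ := Finsupp.ne_iff.1 hc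
    rw [Finsupp.zero_apply] at hj
    -- Only the term at `j` survives; scaling and renaming it would put `x_{0,0}` into `J`.
    have h1 := hJ _ (isGradedHom_keep fun i _ => i = j) _ hf
    rw [Finsupp.sum, map_sum, Finset.sum_eq_single_of_mem j (Finsupp.mem_support_iff.2 hj)
      (fun i _ hi => by simp [keep, hi])] at h1
    have h2 := J.toSubmodule.smul_mem (c j)⁻¹ h1
    have h3 : gvar K j (0 : G) ∈ J := by simpa [keep, smul_smul, hj] using h2
    apply h0
    have h4 := hJ _ (isGradedHom_renameVar fun _ _ => 0) _ h3
    simpa [renameVar] using h4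

lemma exists_controls (he : Distinct e₁ e₂) {J : LieIdeal K (FreeGraded K G)}
    (hJ : IsTIdeal J) : ∃ S : Finset (FreeGraded K G), ∀ ℓ, Controls J e₁ e₂ ℓ S := by
  classical
  obtain ⟨S₀, h₀⟩ := exists_controls_diag (e₁ := e₁) (e₂ := e₂) hJ
  obtain ⟨S₁, h₁⟩ := exists_controls_base he hJ (ℓ := .fst 0) nofun
  obtain ⟨S₂, h₂⟩ := exists_controls_base he hJ (ℓ := .snd 0) nofun
  obtain ⟨S₃, h₃⟩ := exists_controls_base he hJ (ℓ := .corner 0) nofun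
  obtain ⟨S₄, h₄⟩ := exists_controls_base he hJ (ℓ := .mixed 0 0) nofun
  have hS : ((S₀ ∪ S₁ ∪ S₂ ∪ S₃ ∪ S₄ : Finset (FreeGraded K G)) : Set (FreeGraded K G)) ⊆ J := by
    simp only [Finset.coe_union, Set.union_subset_iff]
    exact ⟨⟨⟨⟨h₀.1, (h₁ (.fst 0) rfl).1⟩, (h₂ (.snd 0) rfl).1⟩, (h₃ (.corner 0) rfl).1⟩,
      (h₄ (.mixed 0 0) rfl).1⟩
  refine ⟨S₀ ∪ S₁ ∪ S₂ ∪ S₃ ∪ S₄, fun ℓ => ⟨hS, fun J' hJ' hId hS' => ?_⟩⟩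
  simp only [Finset.coe_union, Set.union_subset_iff] at hS'
  obtain ⟨⟨⟨⟨k₀, k₁⟩, k₂⟩, k₃⟩, k₄⟩ := hS'
  rcases ℓ with _ | i | i | i | ⟨i, k⟩
  · exact h₀.2 J' hJ' hId k₀
  · exact (h₁ _ rfl).2 J' hJ' hId k₁
  · exact (h₂ _ rfl).2 J' hJ' hId k₂
  · exact (h₃ _ rfl).2 J' hJ' hId k₃
  · exact (h₄ _ rfl).2 J' hJ' hId k₄

theorem exists_finset_eq_tSpan_sup (he : Distinct e₁ e₂) {J : LieIdeal K (FreeGraded K G)}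
    (hJ : IsTIdeal J) (hId : idUT K e₁ e₂ ≤ J) :
    ∃ S : Finset (FreeGraded K G),
      J = tSpan (S : Set (FreeGraded K G)) ⊔ idUT K e₁ e₂ := by
  obtain ⟨S, hS⟩ := exists_controls he hJ
  refine ⟨S, le_antisymm (fun f hf => ?_) (sup_le (tSpan_le hJ (hS .diag).1) hId)⟩
  have htop : f ∈ ⨆ ℓ, component K e₁ e₂ ℓ := by rw [iSup_component he]; trivial
  obtain ⟨c, hc, rfl⟩ := (Submodule.mem_iSup_iff_exists_finsupp _ _).1 htop
  exact sum_mem fun ℓ _ => (hS ℓ).2 _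
    ((isTIdeal_tSpan _).sup (isTIdeal_gradedId _)) le_sup_right
    ((subset_tSpan _).trans (SetLike.coe_subset_coe.2 le_sup_left)) _
    (component_mem he hJ hId c hc hf ℓ) (hc ℓ)

lemma distinct_basis (e : Module.Basis (Fin 2) ℤ G) : Distinct (e 0) (e 1) where
  fst_ne := e.ne_zero 0
  snd_ne := e.ne_zero 1
  ne h := absurd (e.injective h) (by decide)
  add_ne h := by
    have := congrArg (fun x => e.repr x 0) h
    simp at this

end FiniteGeneration

end GradedLie

theorem mainTheorem5 {K : Type*} [Field K] [Infinite K]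
    {G : Type*} [AddCommGroup G] (e : Module.Basis (Fin 2) ℤ G)
    (J : LieIdeal K (GradedLie.FreeGraded K G)) (hJ : GradedLie.IsTIdeal J)
    (hId : GradedLie.gradedId (GradedLie.elementaryComponent K (e 0) (e 1)) ≤ J) :
    ∃ S : Finset (GradedLie.FreeGraded K G),
      J = GradedLie.tSpan (S : Set (GradedLie.FreeGraded K G)) ⊔
        GradedLie.gradedId (GradedLie.elementaryComponent K (e 0) (e 1)) :=
  GradedLie.exists_finset_eq_tSpan_sup (GradedLie.distinct_basis e) hJ hId
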